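/- Let $\kappa$ be an infinite cardinal. A group $G$ with $|G| \ge \kappa$ is called $\kappa$-existentially closed if every system of fewer than $\kappa$ equations and inequations (in any set of indeterminates) with coefficients in $G$ which has a solution in some group $L \ge G$ already has a solution in $G$. Lemma. Let $G$ be a $\kappa$-existentially closed group, let $K$ be a group with $|K| < \kappa$, and let $H \le K$ be a subgroup. Then for every injective group homomorphism $\varphi : H \to G$ there exists an injective group homomorphism $\overline{\varphi} : K \to G$ such that $\overline{\varphi}(h) = \varphi(h)$ for all $h \in H$. -/

import Mathlib

open scoped Cardinal

universe u

/-- A system of equations `w = 1` and inequations `w ≠ 1` in the indeterminates `X` with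
coefficients in the group `G`. The two sides are given by group words, that is, elements of the
free product `G ∗ F(X)` of `G` with the free group on `X`. -/
structure GroupSystem (G X : Type u) [Group G] where
  /-- The words `w` for which `w = 1` is required. -/
  equations : Set (Monoid.Coprod G (FreeGroup X))
  /-- The words `w` for which `w ≠ 1` is required. -/
  inequations : Set (Monoid.Coprod G (FreeGroup X))

namespace GroupSystem

variable {G X : Type u} [Group G]

/-- The total number of equations and inequations of a system. -/
def size (S : GroupSystem G X) : Cardinal.{u} :=
  #S.equations + #S.inequations

/-- Evaluation in `L` of a word over `G` and `X`: coefficients are sent to `L` by `ι : G →* L`,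
and each indeterminate `x` is replaced by `s x`. -/
def evalWord {L : Type u} [Group L] (ι : G →* L) (s : X → L) :
    Monoid.Coprod G (FreeGroup X) →* L :=
  Monoid.Coprod.lift ι (FreeGroup.lift s)

/-- `s` is a solution in `L` of the system `S`, the coefficients being read in `L` via `ι`. -/
def IsSolution (S : GroupSystem G X) {L : Type u} [Group L] (ι : G →* L) (s : X → L) : Prop :=
  (∀ w ∈ S.equations, evalWord ι s w = 1) ∧ (∀ w ∈ S.inequations, evalWord ι s w ≠ 1)

end GroupSystem

/-- `G` is `κ`-existentially closed: `|G| ≥ κ`, and every system of fewer than `κ` equations and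
inequations over `G` that has a solution in some group `L` containing `G` (via an embedding `ι`)
has a solution in `G`. -/
def IsExistentiallyClosedGroup (κ : Cardinal.{u}) (G : Type u) [Group G] : Prop :=
  κ ≤ #G ∧
    ∀ (X : Type u) (S : GroupSystem G X), S.size < κ →
      (∃ (L : Type u) (_ : Group L) (ι : G →* L),
        Function.Injective ι ∧ ∃ s : X → L, S.IsSolution ι s) →
      ∃ s : X → G, S.IsSolution (MonoidHom.id G) s

/-! The amalgam of `G` and `K` over `H` contains both, so over `G` its copy of `K` solves the system
that describes embeddings of `K` extending `φ`. This system has fewer than `κ` members, hence a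
solution in `G` itself, which is the embedding sought. -/

/-- The family over `Bool` with value `G` at `true` and `K` at `false`. -/
def BoolFamily (G K : Type u) : Bool → Type u
  | true => G
  | false => K

instance BoolFamily.instGroup (G K : Type u) [Group G] [Group K] : ∀ b, Group (BoolFamily G K b)
  | true => inferInstanceAs (Group G)
  | false => inferInstanceAs (Group K)

/-- Two injective homomorphisms out of a common group can be amalgamated: their codomains embed in
a group in which the two images of the common group agree. -/
theorem exists_amalgam {H G K : Type u} [Group H] [Group G] [Group K] (φ : H →* G) (j : H →* K)
    (hφ : Function.Injective φ) (hj : Function.Injective j) :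
    ∃ (L : Type u) (_ : Group L) (ι : G →* L) (τ : K →* L),
      Function.Injective ι ∧ Function.Injective τ ∧ ∀ h, τ (j h) = ι (φ h) := by
  let f : ∀ b, H →* BoolFamily G K b := fun b => match b with
    | true => φ
    | false => j
  have hf : ∀ b, Function.Injective (f b) := by
    intro b
    cases b
    · exact hj
    · exact hφ
  refine ⟨Monoid.PushoutI f, inferInstance, Monoid.PushoutI.of (φ := f) true,
    Monoid.PushoutI.of (φ := f) false, Monoid.PushoutI.of_injective hf true,
    Monoid.PushoutI.of_injective hf false, fun h => ?_⟩
  exact (Monoid.PushoutI.of_apply_eq_base f false h).trans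
    (Monoid.PushoutI.of_apply_eq_base f true h).symm

namespace GroupSystem

section Evaluation

variable {G X L : Type u} [Group G] [Group L] (ι : G →* L) (s : X → L)

@[simp]
theorem evalWord_inl (g : G) : evalWord ι s (Monoid.Coprod.inl g) = ι g := by
  simp [evalWord]

@[simp]
theorem evalWord_inr_of (x : X) :
    evalWord ι s (Monoid.Coprod.inr (FreeGroup.of x)) = s x := by
  simp [evalWord]

end Evaluation

section Extension

variable {G K : Type u} [Group G] [Group K]

/-- The indeterminate attached to `k`, as a word. -/
def indeterminate (G : Type u) [Group G] (k : K) : Monoid.Coprod G (FreeGroup K) :=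
  Monoid.Coprod.inr (FreeGroup.of k)

/-- The system whose solutions are the injective homomorphisms on `K` extending `φ`: the
multiplication table of `K`, the prescribed values on `H`, and `k ≠ 1` for each `k ≠ 1`. -/
def extension {H : Subgroup K} (φ : H →* G) : GroupSystem G K where
  equations :=
    Set.range (fun p : K × K =>
      indeterminate G p.1 * indeterminate G p.2 * (indeterminate G (p.1 * p.2))⁻¹) ∪
    Set.range (fun h : H => indeterminate G (h : K) * (Monoid.Coprod.inl (φ h))⁻¹)
  inequations := indeterminate G '' {k : K | k ≠ 1}

/-- Only binary sums and products of cardinals below `κ` occur, so `κ` infinite suffices; it need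
not be regular. -/
theorem size_extension_lt {κ : Cardinal.{u}} (hκ : ℵ₀ ≤ κ) (hK : #K < κ) {H : Subgroup K}
    (φ : H →* G) : (extension φ).size < κ := by
  have hmul : #(K × K) < κ := by
    rw [Cardinal.mk_prod, Cardinal.lift_id]
    exact Cardinal.mul_lt_of_lt hκ hK hK
  have hH : #H < κ := (Cardinal.mk_subtype_le _).trans_lt hK
  refine Cardinal.add_lt_of_lt hκ ((Cardinal.mk_union_le _ _).trans_lt ?_) ?_
  · exact Cardinal.add_lt_of_lt hκ (Cardinal.mk_range_le.trans_lt hmul)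
      (Cardinal.mk_range_le.trans_lt hH)
  · exact Cardinal.mk_image_le.trans_lt ((Cardinal.mk_subtype_le _).trans_lt hK)

theorem isSolution_extension_iff {L : Type u} [Group L] {H : Subgroup K} (φ : H →* G)
    (ι : G →* L) (s : K → L) :
    (extension φ).IsSolution ι s ↔
      (∀ a b, s (a * b) = s a * s b) ∧ (∀ h : H, s h = ι (φ h)) ∧ ∀ k, k ≠ 1 → s k ≠ 1 := by
  simp only [IsSolution, extension, indeterminate, Set.mem_union, or_imp, forall_and,
    Set.forall_mem_range, Set.forall_mem_image, Prod.forall, map_mul, map_inv, evalWord_inl,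
    evalWord_inr_of, mul_inv_eq_one, Set.mem_ofPred_eq, and_assoc]
  simp only [eq_comm]

end Extension

end GroupSystem

theorem lemma1p5 (κ : Cardinal.{u}) (hκ : ℵ₀ ≤ κ) (G : Type u) [Group G]
    (hG : IsExistentiallyClosedGroup κ G) (K : Type u) [Group K] (hK : #K < κ)
    (H : Subgroup K) (φ : H →* G) (hφ : Function.Injective φ) :
    ∃ ψ : K →* G, Function.Injective ψ ∧ ∀ h : H, ψ (h : K) = φ h := by
  obtain ⟨L, _, ι, τ, hι, hτ, hιτ⟩ := exists_amalgam φ H.subtype hφ H.subtype_injective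
  obtain ⟨s, hs⟩ := hG.2 K (GroupSystem.extension φ) (GroupSystem.size_extension_lt hκ hK φ)
    ⟨L, _, ι, hι, τ, (GroupSystem.isSolution_extension_iff φ ι τ).2
      ⟨map_mul τ, hιτ, fun k hk => (map_ne_one_iff τ hτ).2 hk⟩⟩
  obtain ⟨hmul, hH, hne⟩ := (GroupSystem.isSolution_extension_iff φ _ s).1 hs
  -- The inequations say exactly that the kernel is trivial.
  refine ⟨MonoidHom.mk' s hmul, (injective_iff_map_eq_one _).2 fun k hk => ?_, hH⟩
  by_contra h
  exact hne k h hk
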